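/- Let $X$ be a compact complex manifold of pure dimension $n$ with an ample holomorphic line bundle $L$, let $V_k=H^0(X,kL)$ be the space of holomorphic sections of $L^{\otimes k}$, $N_k=\dim V_k$, and $R(X,L)=\bigoplus_{k\ge 0}V_k$. A non-Archimedean norm on a complex vector space $V$ is a function $\|\cdot\|:V\to[0,\infty)$ with $\|v\|=0$ iff $v=0$, $\|cv\|=\|v\|$ for $c\in\mathbb C\setminus\{0\}$, and $\|v+w\|\le\max(\|v\|,\|w\|)$. A basis $(v_i)$ of $V$ is orthogonal for $\|\cdot\|$ if there are real numbers $a_i$ with $\|\sum_i c_iv_i\|=\max_{c_i\ne0}e^{-a_i}$ for every nonzero vector. A bounded graded non-Archimedean norm on $R(X,L)$ is a sequence $(\|\cdot\|_k)_{k\ge 0}$ of non-Archimedean norms on the $V_k$ such that $\|s\cdot t\|_{j+k}\le\|s\|_j\|t\|_k$ for all $s\in V_j$, $t\in V_k$, and such that, for some $\delta>0$, one has $e^{-\delta k}\le\|s\|_k\le e^{\delta k}$ for all $k$ and all nonzero $s\in V_k$. Let $\|\cdot\|_\bullet$ be a bounded graded non-Archimedean norm on $R(X,L)$, and for each $k$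 let $(s_{i,k})_{1\le i\le N_k}$ be an orthogonal basis for $\|\cdot\|_k$. Put $\lambda_{i,k}=-\log\|s_{i,k}\|_k$. Let $\sigma$ be the Duistermaat–Heckman measure of $\|\cdot\|_\bullet$, that is, the weak limit of the measures $\sigma_k=k^{-n}\sum_i\delta_{\lambda_{i,k}/k}$ as $k\to\infty$. Let $I\subseteq\mathbb R$ be the smallest interval that contains the support of $\sigma$ and all the points $\lambda_{i,k}/k$ with $k\ge1$ (so that $I$ is the support of $\sigma$ whenever the support is an interval containing these points). Let $f:I\to\mathbb R$ be bounded, decreasing (in the weak sense) and convex. **Theorem 2.1.** For each $k\ge 0$ there is a unique non-Archimedean norm $\|\cdot\|_{k,f}$ on $V_k$ for which $(s_{i,k})_i$ is an orthogonal basis and $$\|s_{i,k}\|_{k,f}=\|s_{i,k}\|_k\,e^{k f(\lambda_{i,k}/k)}\qquad(1\le i\le N_k)$$ (for $k=0$ the factor is $1$), and the sequence $\|\cdot\|_{\bullet,f}$ is again a bounded graded non-Archimedean norm on $R(X,L)$. -/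

import Mathlib

open scoped Manifold ContDiff Topology NNReal TensorProduct
open Filter MeasureTheory Bundle

/-! ### Holomorphic sections of the powers of a holomorphic line bundle -/

section Sections

variable {X : Type*} (L : X → Type*) [TopologicalSpace (TotalSpace ℂ L)]
  [∀ x, AddCommGroup (L x)] [∀ x, Module ℂ (L x)] [∀ x, TopologicalSpace (L x)]
  [TopologicalSpace X] [FiberBundle ℂ L] [VectorBundle ℂ ℂ L]

/-- The trivialization of `L` at the point `x₀` induces on the fibre at `y` of the `k`-th tensor
power of `L` the linear coordinate `v₁ ⊗ ⋯ ⊗ v_k ↦ ∏ i, (coordinate of v_i)`. -/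
noncomputable def powerCoord (k : ℕ) (x₀ y : X) : (⨂[ℂ]^k (L y)) →ₗ[ℂ] ℂ :=
  PiTensorProduct.lift ((MultilinearMap.mkPiAlgebra ℂ (Fin k) ℂ).compLinearMap
    fun _ => (trivializationAt ℂ L x₀).linearMapAt ℂ y)

/-- The product `L_y^{⊗ j} × L_y^{⊗ k} → L_y^{⊗ (j+k)}` is the product of coordinates. -/
theorem powerCoord_mul (j k : ℕ) (x₀ y : X) (a : ⨂[ℂ]^j (L y)) (b : ⨂[ℂ]^k (L y)) :
    powerCoord L (j + k) x₀ y (TensorPower.mulEquiv (a ⊗ₜ[ℂ] b)) =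
      powerCoord L j x₀ y a * powerCoord L k x₀ y b := by
  induction a using PiTensorProduct.induction_on with
  | smul_tprod r a =>
    induction b using PiTensorProduct.induction_on with
    | smul_tprod r' b =>
      have h := TensorPower.tprod_mul_tprod ℂ a b
      rw [TensorPower.gMul_def] at h
      simp only [← TensorProduct.smul_tmul', TensorProduct.tmul_smul, map_smul, h]
      simp only [powerCoord, PiTensorProduct.lift.tprod,
        MultilinearMap.compLinearMap_apply, MultilinearMap.mkPiAlgebra_apply, Fin.prod_univ_add,
        Fin.append_left, Fin.append_right, smul_eq_mul]
      ring
    | add b₁ b₂ h₁ h₂ => rw [TensorProduct.tmul_add, map_add, map_add, map_add, h₁, h₂, mul_add]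
  | add a₁ a₂ h₁ h₂ => rw [TensorProduct.add_tmul, map_add, map_add, map_add, h₁, h₂, add_mul]

variable (n : ℕ) [ChartedSpace (EuclideanSpace ℂ (Fin n)) X]

/-- `H⁰(X, kL)`: the complex vector space of global holomorphic sections of the `k`-th tensor
power of the line bundle `L` over the `n`-dimensional complex manifold `X`. A section is
holomorphic if its coordinates in the local trivializations of `L` are holomorphic. -/
noncomputable def holSections (k : ℕ) : Submodule ℂ (∀ x, ⨂[ℂ]^k (L x)) where
  carrier := {s | ∀ x₀ : X, ContMDiffOn 𝓘(ℂ, EuclideanSpace ℂ (Fin n)) 𝓘(ℂ, ℂ) ω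
    (fun y => powerCoord L k x₀ y (s y)) (trivializationAt ℂ L x₀).baseSet}
  add_mem' {s t} hs ht x₀ := by
    simp only [Pi.add_apply, map_add]
    exact (hs x₀).add (ht x₀)
  zero_mem' x₀ := by
    simpa only [Pi.zero_apply, map_zero] using contMDiffOn_const
  smul_mem' c s hs x₀ := by
    simp only [Pi.smul_apply, map_smul]
    exact (contMDiffOn_const (I' := 𝓘(ℂ, ℂ)) (c := c)).smul (hs x₀)

variable {n L} in
/-- The multiplication `H⁰(X, jL) × H⁰(X, kL) → H⁰(X, (j+k)L)` of the section ring `R(X, L)`: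
the pointwise tensor product of sections. -/
noncomputable def sectionMul {j k : ℕ} (s : holSections L n j) (t : holSections L n k) :
    holSections L n (j + k) :=
  ⟨fun y => TensorPower.mulEquiv (s.1 y ⊗ₜ[ℂ] t.1 y), fun x₀ => by
    simp only [powerCoord_mul, ← smul_eq_mul]
    exact (s.2 x₀).smul (t.2 x₀)⟩

/-- `kL` is very ample: its global holomorphic sections have no common zero, separate points,
and separate tangent vectors (that is, they define a holomorphic embedding of the compact
manifold `X` into a projective space). The differential at `x` of a section vanishing at `x` is
read in the trivialization at `x`. -/
def IsVeryAmplePower (k : ℕ) : Prop :=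
  (∀ x, ∃ s : holSections L n k, s.1 x ≠ 0) ∧
  (∀ x y, x ≠ y → ∃ s : holSections L n k, s.1 x = 0 ∧ s.1 y ≠ 0) ∧
  (∀ (x : X) (v : TangentSpace 𝓘(ℂ, EuclideanSpace ℂ (Fin n)) x), v ≠ 0 →
    ∃ s : holSections L n k, s.1 x = 0 ∧
      mfderiv 𝓘(ℂ, EuclideanSpace ℂ (Fin n)) 𝓘(ℂ, ℂ)
        (fun y => powerCoord L k x y (s.1 y)) x v ≠ 0)

/-- `L` is ample: some positive power of `L` is very ample. -/
def IsAmpleLineBundle : Prop := ∃ k : ℕ, 1 ≤ k ∧ IsVeryAmplePower L n k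

end Sections

/-! ### Non-Archimedean norms -/

section Norms

variable {V : Type*} [AddCommGroup V] [Module ℂ V]

/-- Non-Archimedean norms on a complex vector space, with respect to the trivial absolute value
of `ℂ`. -/
structure IsNANorm (N : V → ℝ) : Prop where
  nonneg : ∀ v, 0 ≤ N v
  eq_zero_iff : ∀ v, N v = 0 ↔ v = 0
  smul : ∀ (c : ℂ) (v : V), c ≠ 0 → N (c • v) = N v
  add_le : ∀ v w, N (v + w) ≤ max (N v) (N w)

open Classical in
/-- The trivial norm. -/
noncomputable def trivialNANorm (v : V) : ℝ := if v = 0 then 0 else 1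

/-- The basis `b` is orthogonal for `N`: there are real numbers `a i` with
`N (∑ c i • b i) = max {e ^ (- a i) | c i ≠ 0}` for every nonzero vector `∑ c i • b i`. -/
def IsNAOrthogonal {ι : Type*} (N : V → ℝ) (b : Module.Basis ι ℂ V) : Prop :=
  ∃ a : ι → ℝ, ∀ v, v ≠ 0 →
    IsGreatest ((fun i => Real.exp (-a i)) '' {i | b.repr v i ≠ 0}) (N v)

/-- `N'` is the rescaling of `N` in degree `k` by the function `f` along the basis `b`: the
non-Archimedean norm for which `b` is orthogonal, and with
`N' (b i) = N (b i) * e ^ (k f (- k⁻¹ log N (b i)))`. (For `k = 0` the factor is `1`.) -/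
structure IsRescaling {ι : Type*} (f : ℝ → ℝ) (k : ℕ) (N : V → ℝ) (b : Module.Basis ι ℂ V)
    (N' : V → ℝ) : Prop where
  isNANorm : IsNANorm N'
  orthogonal : IsNAOrthogonal N' b
  apply_basis : ∀ i,
    N' (b i) = N (b i) * Real.exp (k * f (-(k : ℝ)⁻¹ * Real.log (N (b i))))

end Norms

section Graded

variable {X : Type*} {L : X → Type*} [TopologicalSpace (TotalSpace ℂ L)]
  [∀ x, AddCommGroup (L x)] [∀ x, Module ℂ (L x)] [∀ x, TopologicalSpace (L x)]
  [TopologicalSpace X] [FiberBundle ℂ L] [VectorBundle ℂ ℂ L]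
  {n : ℕ} [ChartedSpace (EuclideanSpace ℂ (Fin n)) X]

/-- Bounded graded non-Archimedean norms on `R(X, L) = ⨁ k, H⁰(X, kL)`. -/
structure IsBoundedGradedNANorm (N : ∀ k, holSections L n k → ℝ) : Prop where
  isNANorm : ∀ k, IsNANorm (N k)
  mul_le : ∀ (j k : ℕ) (s : holSections L n j) (t : holSections L n k),
    N (j + k) (sectionMul s t) ≤ N j s * N k t
  bounded : ∃ δ : ℝ, 0 < δ ∧ ∀ (k : ℕ) (s : holSections L n k),
    Real.exp (-(δ * k)) * trivialNANorm s ≤ N k s ∧ N k s ≤ Real.exp (δ * k) * trivialNANorm s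

/-- The measure `σ_k = k^{-n} ∑ i, δ_{- k⁻¹ log ‖s_{i,k}‖_k}`, for a basis `s_{i,k}` of
`H⁰(X, kL)`. -/
noncomputable def spectralMeasure (N : ∀ k, holSections L n k → ℝ)
    (s : ∀ k, Module.Basis (Fin (Module.finrank ℂ (holSections L n k))) ℂ (holSections L n k))
    (k : ℕ) : FiniteMeasure ℝ :=
  ((k : ℝ≥0) ^ n)⁻¹ • ∑ i, ProbabilityMeasure.toFiniteMeasure
    ⟨Measure.dirac (-(k : ℝ)⁻¹ * Real.log (N k (s k i))), inferInstance⟩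

/-- The Duistermaat-Heckman measure: the limit of the measures `σ_k` for the weak topology
(convergence against bounded continuous functions). The weak topology is Hausdorff, so the limit
is unique. -/
noncomputable def duistermaatHeckman (N : ∀ k, holSections L n k → ℝ)
    (s : ∀ k, Module.Basis (Fin (Module.finrank ℂ (holSections L n k))) ℂ (holSections L n k)) :
    FiniteMeasure ℝ :=
  limUnder atTop (spectralMeasure N s)

/-- The set of the points `- k⁻¹ log ‖s_{i,k}‖_k`, `k ≥ 1`, where the rescaling construction
evaluates the function `f`. -/
def normalizedJumps (N : ∀ k, holSections L n k → ℝ)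
    (s : ∀ k, Module.Basis (Fin (Module.finrank ℂ (holSections L n k))) ℂ (holSections L n k)) :
    Set ℝ :=
  {x | ∃ k : ℕ, 1 ≤ k ∧ ∃ i, x = -(k : ℝ)⁻¹ * Real.log (N k (s k i))}

/-- The smallest interval that contains the support of the Duistermaat-Heckman measure and all
the points `- k⁻¹ log ‖s_{i,k}‖_k`, `k ≥ 1`. If the support is an interval that contains these
points, then it is the support. -/
def rescalingDomain (N : ∀ k, holSections L n k → ℝ)
    (s : ∀ k, Module.Basis (Fin (Module.finrank ℂ (holSections L n k))) ℂ (holSections L n k)) :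
    Set ℝ :=
  convexHull ℝ ((duistermaatHeckman N s : Measure ℝ).support ∪ normalizedJumps N s)

end Graded

/-! ### The one-variable rescaling of norm values. -/

section Rescale

/-! The rescaled norm is the composite `φ_k ∘ N k`, where `φ_k = rescale f k` satisfies `log (φ_k t)
= log t + k f(-k⁻¹ log t)`. Since `f` decreases, `φ_k` is increasing, so it commutes with maxima;
this preserves both the ultrametric inequality and orthogonality (`IsNAOrthogonal.isRescaling`).
Values on an orthogonal basis determine a norm, whence uniqueness. For submultiplicativity,
monotonicity bounds the new norm of `s * t` by `φ_{j+k}(N s * N t)`, and convexity of `f` gives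
`φ_{j+k}(r t) ≤ φ_j(r) φ_k(t)` (`ConvexOn.rescale_mul_le`). A bound on `f` distorts the degree `k`
norm by at most `e^{± C k}`. -/

/-- The rescaling by `f` of the value `t` of a norm in degree `k`. -/
noncomputable def rescale (f : ℝ → ℝ) (k : ℕ) (t : ℝ) : ℝ :=
  t * Real.exp (k * f (-(k : ℝ)⁻¹ * Real.log t))

@[simp]
theorem rescale_zero_right (f : ℝ → ℝ) (k : ℕ) : rescale f k 0 = 0 := by
  simp [rescale]

@[simp]
theorem rescale_zero_left (f : ℝ → ℝ) (t : ℝ) : rescale f 0 t = t := by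
  simp [rescale]

theorem rescale_nonneg {f : ℝ → ℝ} {k : ℕ} {t : ℝ} (ht : 0 ≤ t) : 0 ≤ rescale f k t :=
  mul_nonneg ht (Real.exp_nonneg _)

theorem rescale_pos {f : ℝ → ℝ} {k : ℕ} {t : ℝ} (ht : 0 < t) : 0 < rescale f k t :=
  mul_pos ht (Real.exp_pos _)

theorem rescale_eq_exp (f : ℝ → ℝ) (k : ℕ) {t : ℝ} (ht : 0 < t) :
    rescale f k t = Real.exp (Real.log t + k * f (-(k : ℝ)⁻¹ * Real.log t)) := by
  rw [Real.exp_add, Real.exp_log ht, rescale]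

/-- The positive reals `t` whose normalized logarithm `- k⁻¹ log t` lies in `I` if `1 ≤ k`, and
only `t = 1` if `k = 0`. -/
def valuesOver (I : Set ℝ) (k : ℕ) : Set ℝ :=
  {t | 0 < t ∧ (k = 0 → t = 1) ∧ (1 ≤ k → -(k : ℝ)⁻¹ * Real.log t ∈ I)}

variable {f : ℝ → ℝ} {I : Set ℝ}

theorem AntitoneOn.monotoneOn_rescale (hf : AntitoneOn f I) (k : ℕ) :
    MonotoneOn (rescale f k) (valuesOver I k) := by
  intro r hr t ht hrt
  rcases k.eq_zero_or_pos with rfl | hk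
  · simpa using hrt
  have hlog : Real.log r ≤ Real.log t := Real.log_le_log hr.1 hrt
  have hf' := hf (ht.2.2 hk) (hr.2.2 hk)
    (mul_le_mul_of_nonpos_left hlog (neg_nonpos.2 (by positivity : (0 : ℝ) ≤ (k : ℝ)⁻¹)))
  rw [rescale_eq_exp f k hr.1, rescale_eq_exp f k ht.1]
  gcongr

theorem neg_inv_mul_log_mul {j k : ℕ} (hj : 1 ≤ j) (hk : 1 ≤ k) {r t : ℝ} (hr : 0 < r)
    (ht : 0 < t) :
    -((j + k : ℕ) : ℝ)⁻¹ * Real.log (r * t) =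
      ((j : ℝ) / (j + k)) • (-(j : ℝ)⁻¹ * Real.log r) +
        ((k : ℝ) / (j + k)) • (-(k : ℝ)⁻¹ * Real.log t) := by
  have hj' : (0 : ℝ) < j := by exact_mod_cast hj
  have hk' : (0 : ℝ) < k := by exact_mod_cast hk
  rw [Real.log_mul hr.ne' ht.ne', smul_eq_mul, smul_eq_mul]
  push_cast
  field_simp
  ring

/-- The product of two norm values need not be a norm value; convexity of the domain is what lets
`f` be used there. -/
theorem Convex.mul_mem_valuesOver (hI : Convex ℝ I) {j k : ℕ} {r t : ℝ}
    (hr : r ∈ valuesOver I j) (ht : t ∈ valuesOver I k) : r * t ∈ valuesOver I (j + k) := by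
  rcases j.eq_zero_or_pos with rfl | hj
  · simpa [hr.2.1 rfl] using ht
  rcases k.eq_zero_or_pos with rfl | hk
  · simpa [ht.2.1 rfl] using hr
  have hjk : (0 : ℝ) < j + k := by exact_mod_cast Nat.add_pos_left hj k
  refine ⟨mul_pos hr.1 ht.1, by lia, fun _ => ?_⟩
  rw [neg_inv_mul_log_mul hj hk hr.1 ht.1]
  exact hI (hr.2.2 hj) (ht.2.2 hk) (by positivity) (by positivity) (by field_simp)

/-- After taking logarithms, the terms `log r + log t` cancel and what remains is convexity of `f`
with weights `j/(j+k)` and `k/(j+k)`, multiplied by `j+k`. -/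
theorem ConvexOn.rescale_mul_le (hf : ConvexOn ℝ I f) {j k : ℕ} {r t : ℝ}
    (hr : r ∈ valuesOver I j) (ht : t ∈ valuesOver I k) :
    rescale f (j + k) (r * t) ≤ rescale f j r * rescale f k t := by
  rcases j.eq_zero_or_pos with rfl | hj
  · simp [hr.2.1 rfl]
  rcases k.eq_zero_or_pos with rfl | hk
  · simp [ht.2.1 rfl]
  have hjk : (0 : ℝ) < j + k := by exact_mod_cast Nat.add_pos_left hj k
  have hconv := hf.2 (hr.2.2 hj) (ht.2.2 hk) (by positivity : (0 : ℝ) ≤ (j : ℝ) / (j + k))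
    (by positivity : (0 : ℝ) ≤ (k : ℝ) / (j + k)) (by field_simp)
  rw [← neg_inv_mul_log_mul hj hk hr.1 ht.1] at hconv
  have hmul := mul_le_mul_of_nonneg_left hconv hjk.le
  have hsplit (x y : ℝ) :
      ((j : ℝ) + k) * (((j : ℝ) / (j + k)) • x + ((k : ℝ) / (j + k)) • y) = j * x + k * y := by
    simp only [smul_eq_mul]
    field_simp
  rw [hsplit] at hmul
  rw [rescale_eq_exp f _ (mul_pos hr.1 ht.1), rescale_eq_exp f j hr.1, rescale_eq_exp f k ht.1,
    ← Real.exp_add, Real.exp_le_exp, Real.log_mul hr.1.ne' ht.1.ne']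
  rw [Real.log_mul hr.1.ne' ht.1.ne'] at hmul
  push_cast at hmul ⊢
  linarith

theorem rescale_bounds {C : ℝ} (hC : ∀ x ∈ I, |f x| ≤ C) {k : ℕ} {t : ℝ}
    (ht : t ∈ valuesOver I k) :
    Real.exp (-(C * k)) * t ≤ rescale f k t ∧ rescale f k t ≤ Real.exp (C * k) * t := by
  rcases k.eq_zero_or_pos with rfl | hk
  · simp
  have h := abs_le.1 (hC _ (ht.2.2 hk))
  have hk' : (0 : ℝ) ≤ k := k.cast_nonneg
  rw [rescale, mul_comm t]
  constructor <;> refine mul_le_mul_of_nonneg_right (Real.exp_le_exp.2 ?_) ht.1.le <;> nlinarith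

end Rescale

/-! ### Orthogonal bases and monotone changes of norm. -/

section Orthogonal

variable {V : Type*} [AddCommGroup V] [Module ℂ V] {ι : Type*} {N N' : V → ℝ}
  {b : Module.Basis ι ℂ V}

theorem IsNANorm.pos (hN : IsNANorm N) {v : V} (hv : v ≠ 0) : 0 < N v :=
  (hN.nonneg v).lt_of_ne fun h => hv ((hN.eq_zero_iff v).1 h.symm)

theorem IsNAOrthogonal.isGreatest (hb : IsNAOrthogonal N b) {v : V} (hv : v ≠ 0) :
    IsGreatest ((fun i => N (b i)) '' {i | b.repr v i ≠ 0}) (N v) := by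
  obtain ⟨a, ha⟩ := hb
  have hbasis (i : ι) : N (b i) = Real.exp (-a i) := by
    classical
    -- The only nonzero coordinate of `b i` is the `i`-th, so the maximum is attained there.
    obtain ⟨⟨j, hj, hji⟩, -⟩ := ha (b i) (b.ne_zero i)
    obtain rfl : i = j := by
      by_contra hij
      simp [hij] at hj
    exact hji.symm
  simpa only [hbasis] using ha v hv

theorem IsNAOrthogonal.exists_eq (hb : IsNAOrthogonal N b) {v : V} (hv : v ≠ 0) :
    ∃ i, N v = N (b i) := by
  obtain ⟨⟨i, -, hi⟩, -⟩ := hb.isGreatest hv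
  exact ⟨i, hi.symm⟩

theorem IsNAOrthogonal.of_isGreatest (hpos : ∀ i, 0 < N (b i))
    (h : ∀ v, v ≠ 0 → IsGreatest ((fun i => N (b i)) '' {i | b.repr v i ≠ 0}) (N v)) :
    IsNAOrthogonal N b :=
  ⟨fun i => -Real.log (N (b i)), by simpa only [neg_neg, Real.exp_log (hpos _)] using h⟩

/-- A non-Archimedean norm is determined by its values on an orthogonal basis. -/
theorem IsNAOrthogonal.ext (hN : IsNANorm N) (hN' : IsNANorm N') (hb : IsNAOrthogonal N b)
    (hb' : IsNAOrthogonal N' b) (h : ∀ i, N (b i) = N' (b i)) : N = N' := by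
  funext v
  by_cases hv : v = 0
  · rw [(hN.eq_zero_iff v).2 hv, (hN'.eq_zero_iff v).2 hv]
  · have hg := hb.isGreatest hv
    simp only [h] at hg
    exact hg.unique (hb'.isGreatest hv)

variable {f : ℝ → ℝ} {k : ℕ} {S : Set ℝ}

theorem IsNANorm.rescale (hN : IsNANorm N) (hS : ∀ v, v ≠ 0 → N v ∈ S)
    (hf : MonotoneOn (rescale f k) S) : IsNANorm fun v => _root_.rescale f k (N v) where
  nonneg v := rescale_nonneg (hN.nonneg v)
  eq_zero_iff v := by
    refine ⟨fun h => by_contra fun hv => (rescale_pos (hN.pos hv)).ne' h, fun hv => ?_⟩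
    simp [(hN.eq_zero_iff v).2 hv]
  smul c v hc := by simp only [hN.smul c v hc]
  add_le v w := by
    by_cases hvw : v + w = 0
    · simp only [(hN.eq_zero_iff _).2 hvw, rescale_zero_right]
      exact le_max_of_le_left (rescale_nonneg (hN.nonneg v))
    by_cases hv : v = 0
    · subst hv
      simp
    by_cases hw : w = 0
    · subst hw
      simp
    rcases le_max_iff.1 (hN.add_le v w) with h | h
    · exact le_max_of_le_left (hf (hS _ hvw) (hS _ hv) h)
    · exact le_max_of_le_right (hf (hS _ hvw) (hS _ hw) h)

theorem IsNAOrthogonal.isRescaling (hN : IsNANorm N) (hb : IsNAOrthogonal N b)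
    (hS : ∀ v, v ≠ 0 → N v ∈ S) (hf : MonotoneOn (rescale f k) S) :
    IsRescaling f k N b fun v => rescale f k (N v) where
  isNANorm := hN.rescale hS hf
  orthogonal := by
    refine .of_isGreatest (fun i => rescale_pos (hN.pos (b.ne_zero i))) fun v hv => ?_
    have hsub : (fun i => N (b i)) '' {i | b.repr v i ≠ 0} ⊆ S := by
      rintro _ ⟨i, -, rfl⟩
      exact hS _ (b.ne_zero i)
    simpa only [Set.image_image] using (hf.mono hsub).map_isGreatest (hb.isGreatest hv)
  apply_basis _ := rfl

theorem IsRescaling.unique {N₁ N₂ : V → ℝ} (h₁ : IsRescaling f k N b N₁)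
    (h₂ : IsRescaling f k N b N₂) : N₁ = N₂ :=
  h₁.orthogonal.ext h₁.isNANorm h₂.isNANorm h₂.orthogonal fun i =>
    (h₁.apply_basis i).trans (h₂.apply_basis i).symm

end Orthogonal

/-! ### Graded norms on the section ring. -/

section Graded

variable {X : Type*} {L : X → Type*} [TopologicalSpace (TotalSpace ℂ L)]
  [∀ x, AddCommGroup (L x)] [∀ x, Module ℂ (L x)] [∀ x, TopologicalSpace (L x)]
  [TopologicalSpace X] [FiberBundle ℂ L] [VectorBundle ℂ ℂ L]
  {n : ℕ} [ChartedSpace (EuclideanSpace ℂ (Fin n)) X]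
  {N : ∀ k, holSections L n k → ℝ}

theorem IsBoundedGradedNANorm.apply_degree_zero (hN : IsBoundedGradedNANorm N)
    {v : holSections L n 0} (hv : v ≠ 0) : N 0 v = 1 := by
  obtain ⟨δ, -, h⟩ := hN.bounded
  have h0 := h 0 v
  simp only [trivialNANorm, if_neg hv, Nat.cast_zero, mul_zero, neg_zero, Real.exp_zero,
    mul_one] at h0
  exact le_antisymm h0.2 h0.1

theorem IsBoundedGradedNANorm.mem_valuesOver (hN : IsBoundedGradedNANorm N)
    {s : ∀ k, Module.Basis (Fin (Module.finrank ℂ (holSections L n k))) ℂ (holSections L n k)}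
    (hs : ∀ k, IsNAOrthogonal (N k) (s k)) (k : ℕ) (v : holSections L n k) (hv : v ≠ 0) :
    N k v ∈ valuesOver (rescalingDomain N s) k := by
  refine ⟨(hN.isNANorm k).pos hv, ?_, fun hk => subset_convexHull ℝ _ (.inr ?_)⟩
  · rintro rfl
    exact hN.apply_degree_zero hv
  · obtain ⟨i, hi⟩ := (hs k).exists_eq hv
    exact ⟨k, hk, i, by rw [hi]⟩

/-- Rescaling by a bounded, decreasing and convex function preserves bounded graded
non-Archimedean norms. -/
theorem IsBoundedGradedNANorm.rescale (hN : IsBoundedGradedNANorm N) {I : Set ℝ}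
    (hI : ∀ k v, v ≠ 0 → N k v ∈ valuesOver I k) {f : ℝ → ℝ}
    (hf_bdd : ∃ C : ℝ, ∀ x ∈ I, |f x| ≤ C) (hf_anti : AntitoneOn f I)
    (hf_conv : ConvexOn ℝ I f) :
    IsBoundedGradedNANorm fun k v => _root_.rescale f k (N k v) where
  isNANorm k := (hN.isNANorm k).rescale (hI k) (hf_anti.monotoneOn_rescale k)
  mul_le j k s t := by
    have hnonneg : 0 ≤ _root_.rescale f j (N j s) * _root_.rescale f k (N k t) :=
      mul_nonneg (rescale_nonneg ((hN.isNANorm j).nonneg s))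
        (rescale_nonneg ((hN.isNANorm k).nonneg t))
    -- Monotonicity of the rescaling is known only on positive values, so a zero product is treated
    -- apart.
    by_cases hst : sectionMul s t = 0
    · simpa only [((hN.isNANorm _).eq_zero_iff _).2 hst, rescale_zero_right] using hnonneg
    have hle := hN.mul_le j k s t
    have hpos := ((hN.isNANorm _).pos hst).trans_le hle
    have hs : s ≠ 0 := fun h => by
      simp [((hN.isNANorm j).eq_zero_iff s).2 h] at hpos
    have ht : t ≠ 0 := fun h => by
      simp [((hN.isNANorm k).eq_zero_iff t).2 h] at hpos
    exact (hf_anti.monotoneOn_rescale (j + k) (hI _ _ hst)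
      (hf_conv.1.mul_mem_valuesOver (hI j s hs) (hI k t ht)) hle).trans
      (hf_conv.rescale_mul_le (hI j s hs) (hI k t ht))
  bounded := by
    obtain ⟨δ, hδ, hbd⟩ := hN.bounded
    obtain ⟨C, hC⟩ := hf_bdd
    -- `C` may be negative if the domain is empty, hence `|C|`.
    refine ⟨δ + |C|, by positivity, fun k v => ?_⟩
    by_cases hv : v = 0
    · simp [hv, trivialNANorm, ((hN.isNANorm k).eq_zero_iff 0).2 rfl]
    have hv' := rescale_bounds (fun x hx => (hC x hx).trans (le_abs_self C)) (hI k v hv)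
    have hbd' := hbd k v
    rw [show -((δ + |C|) * (k : ℝ)) = -(|C| * k) + -(δ * k) by ring, add_comm δ, add_mul,
      Real.exp_add, Real.exp_add, mul_assoc, mul_assoc]
    exact ⟨(mul_le_mul_of_nonneg_left hbd'.1 (Real.exp_nonneg _)).trans hv'.1,
      hv'.2.trans (mul_le_mul_of_nonneg_left hbd'.2 (Real.exp_nonneg _))⟩

end Graded

theorem theorem2p1 {n : ℕ} {X : Type*} [TopologicalSpace X] [T2Space X] [CompactSpace X]
    [ChartedSpace (EuclideanSpace ℂ (Fin n)) X]
    [IsManifold 𝓘(ℂ, EuclideanSpace ℂ (Fin n)) ω X]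
    {L : X → Type*} [TopologicalSpace (TotalSpace ℂ L)]
    [∀ x, AddCommGroup (L x)] [∀ x, Module ℂ (L x)] [∀ x, TopologicalSpace (L x)]
    [FiberBundle ℂ L] [VectorBundle ℂ ℂ L]
    [ContMDiffVectorBundle ω ℂ L 𝓘(ℂ, EuclideanSpace ℂ (Fin n))]
    (hL : IsAmpleLineBundle L n)
    (N : ∀ k, holSections L n k → ℝ) (hN : IsBoundedGradedNANorm N)
    (s : ∀ k, Module.Basis (Fin (Module.finrank ℂ (holSections L n k))) ℂ (holSections L n k))
    (hs : ∀ k, IsNAOrthogonal (N k) (s k))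
    (f : ℝ → ℝ)
    (hf_bdd : ∃ C : ℝ, ∀ x ∈ rescalingDomain N s, |f x| ≤ C)
    (hf_anti : AntitoneOn f (rescalingDomain N s))
    (hf_conv : ConvexOn ℝ (rescalingDomain N s) f) :
    (∃! N' : ∀ k, holSections L n k → ℝ, ∀ k, IsRescaling f k (N k) (s k) (N' k)) ∧
    ∀ N' : ∀ k, holSections L n k → ℝ, (∀ k, IsRescaling f k (N k) (s k) (N' k)) →
      IsBoundedGradedNANorm N' := by
  have hI := hN.mem_valuesOver hs
  have hresc (k : ℕ) : IsRescaling f k (N k) (s k) fun v => rescale f k (N k v) :=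
    (hs k).isRescaling (hN.isNANorm k) (hI k) (hf_anti.monotoneOn_rescale k)
  have huniq (N' : ∀ k, holSections L n k → ℝ)
      (hN' : ∀ k, IsRescaling f k (N k) (s k) (N' k)) :
      N' = fun k v => rescale f k (N k v) :=
    funext fun k => (hN' k).unique (hresc k)
  refine ⟨⟨_, hresc, huniq⟩, fun N' hN' => ?_⟩
  rw [huniq N' hN']
  exact hN.rescale hI hf_bdd hf_anti hf_conv
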